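/- For $n\ge 2$ and $m,k\in\mathbb{Z}/n$ let $G_n(m,k)=\langle x_0,\ldots,x_{n-1}\mid x_ix_{i+m}=x_{i+k}\ (0\le i<n)\rangle$ (subscripts mod $n$), and let $H(n,m)=G_n(m,1)$ be the Gilbert–Howie group. Let $E=H(9,4)\rtimes_\theta\langle t\mid t^9\rangle$, where $t$ acts as the shift automorphism $\theta: x_i\mapsto x_{i+1}$. For $q\in\mathbb{Z}$ let $BS(1,q)=\langle a,b\mid bab^{-1}=a^q\rangle$ be the Baumslag–Solitar group. A group contains $B$ if it has a subgroup isomorphic to $B$; a group is hyperbolic if it has a finite generating set whose word metric $d$ satisfies, for some $\delta\ge 0$, Gromov's four-point condition $d(x,y)+d(z,w)\le\max\{d(x,z)+d(y,w),\,d(x,w)+d(y,z)\}+2\delta$ for all $x,y,z,w$. Suppose that every finite subgroup of $H(9,4)$ has order at most $2$ (as is the case, in particular, if $H(9,4)$ is torsion-free). Then the shift extension $E$, in which $H(9,4)$ is a normal subgroup of index $9$, contains $BS(1,-8)$; the group $H(9,4)$ itself contains $BS(1,-512)=BS(1,(-8)^3)$; and $H(9,4)$ is not hyperbolic. -/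

import Mathlib

/-! ### Groups of Fibonacci type -/

/-- The relators `x i * x (i + m) * (x (i + k))⁻¹`, subscripts mod `n`. -/
def fibonacciTypeRels (n : ℕ) (m k : ZMod n) : Set (FreeGroup (ZMod n)) :=
  Set.range fun i : ZMod n =>
    FreeGroup.of i * FreeGroup.of (i + m) * (FreeGroup.of (i + k))⁻¹

/-- The group of Fibonacci type
`G_n(m,k) = ⟨x_0, …, x_{n-1} | x_i x_{i+m} = x_{i+k} (0 ≤ i < n)⟩`, subscripts mod `n`. -/
abbrev FibonacciTypeGroup (n : ℕ) (m k : ZMod n) : Type :=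
  PresentedGroup (fibonacciTypeRels n m k)

/-- The Gilbert–Howie group `H(n,m) = G_n(m,1)`. -/
abbrev GilbertHowieGroup (n : ℕ) (m : ZMod n) : Type :=
  FibonacciTypeGroup n m 1

namespace FibonacciTypeGroup

variable {n : ℕ} {m k : ZMod n}

theorem of_mul_of (i : ZMod n) :
    (PresentedGroup.of i : FibonacciTypeGroup n m k) * PresentedGroup.of (i + m)
      = PresentedGroup.of (i + k) := by
  have h := PresentedGroup.one_of_mem (rels := fibonacciTypeRels n m k) (Set.mem_range_self i)
  simp only [map_mul, map_inv] at h
  exact mul_inv_eq_one.mp h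

/-- The endomorphism `x_i ↦ x_{i+j}`. -/
def shift (n : ℕ) (m k j : ZMod n) : FibonacciTypeGroup n m k →* FibonacciTypeGroup n m k :=
  PresentedGroup.toGroup (f := fun i => PresentedGroup.of (i + j)) (by
    rintro _ ⟨i, rfl⟩
    simp only [map_mul, map_inv, FreeGroup.lift_apply_of]
    rw [mul_inv_eq_one, add_right_comm i m j, add_right_comm i k j]
    exact of_mul_of (i + j))

@[simp]
theorem shift_of (i j : ZMod n) :
    shift n m k j (PresentedGroup.of i) = PresentedGroup.of (i + j) :=
  PresentedGroup.toGroup.of _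

theorem shift_zero : shift n m k 0 = MonoidHom.id _ := by
  ext i
  simp

theorem shift_comp (j l : ZMod n) :
    (shift n m k j).comp (shift n m k l) = shift n m k (j + l) := by
  ext i
  simp [add_assoc, add_comm j l]

/-- The action of the cyclic group `⟨t | t^n⟩` on `G_n(m,k)` in which `t` acts as the
shift automorphism `x_i ↦ x_{i+1}`; thus `t^j` acts as `x_i ↦ x_{i+j}`. -/
def shiftAction (n : ℕ) (m k : ZMod n) :
    Multiplicative (ZMod n) →* MulAut (FibonacciTypeGroup n m k) where
  toFun j := MonoidHom.toMulEquiv (shift n m k j.toAdd) (shift n m k (-j.toAdd))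
    (by rw [shift_comp, neg_add_cancel, shift_zero])
    (by rw [shift_comp, add_neg_cancel, shift_zero])
  map_one' := by
    ext x
    exact DFunLike.congr_fun (shift_zero (n := n) (m := m) (k := k)) x
  map_mul' j l := by
    ext x
    exact (DFunLike.congr_fun (shift_comp (n := n) (m := m) (k := k) j.toAdd l.toAdd) x).symm

end FibonacciTypeGroup

/-- The shift extension `E = G_n(m,k) ⋊ ⟨t | t^n⟩`. -/
abbrev ShiftExtension (n : ℕ) (m k : ZMod n) : Type :=
  FibonacciTypeGroup n m k ⋊[FibonacciTypeGroup.shiftAction n m k] Multiplicative (ZMod n)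

/-! ### Baumslag–Solitar groups -/

/-- The Baumslag–Solitar group `BS(p,q) = ⟨a, b | b a^p b⁻¹ = a^q⟩`, where `a` and `b` are the
generators indexed by `0` and `1`. -/
abbrev BaumslagSolitarGroup (p q : ℤ) : Type :=
  PresentedGroup
    ({FreeGroup.of 1 * FreeGroup.of 0 ^ p * (FreeGroup.of 1)⁻¹ * (FreeGroup.of 0 ^ q)⁻¹} :
      Set (FreeGroup (Fin 2)))

/-- `G` contains (an isomorphic copy of) the group `B`. -/
def ContainsGroup (G B : Type*) [Group G] [Group B] : Prop :=
  ∃ f : B →* G, Function.Injective f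

/-! ### Hyperbolic groups -/

/-- A group is (word-)hyperbolic if, for some finite generating set `S`, the word metric (the
graph metric of the Cayley graph of `G` with respect to `S`) satisfies Gromov's four-point
condition for some `δ`. -/
def IsHyperbolicGroup (G : Type*) [Group G] : Prop :=
  ∃ S : Set G, S.Finite ∧ Subgroup.closure S = ⊤ ∧
    ∃ δ : ℕ, ∀ x y z w : G,
      (SimpleGraph.mulCayley S).dist x y + (SimpleGraph.mulCayley S).dist z w ≤
        max ((SimpleGraph.mulCayley S).dist x z + (SimpleGraph.mulCayley S).dist y w)
          ((SimpleGraph.mulCayley S).dist x w + (SimpleGraph.mulCayley S).dist y z) + 2 * δ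

/-! In H(9,4) six defining relations combine to x_8⁻¹ x_1 x_8 = x_0⁻². As t x_0 t⁻¹ = x_1 in E, the
element s = x_8⁻¹ t conjugates x_0 to x_0⁻². Hence s³ conjugates x_0 to x_0^(-8), while s⁹ lies in
H(9,4) and conjugates x_0 to x_0^(-512). The order of x_0 is infinite: x_0 maps to a generator of a
group of order 19, so a finite order would be a multiple of 19, which the bound 2 on finite
subgroups excludes. For a of infinite order and |q| ≥ 2, a relation b a b⁻¹ = a^q already generates
a copy of BS(1,q), by the normal form b⁻ⁱ aⁿ bʲ. Such a relation makes exponentially many powers of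
a short, whereas in a hyperbolic group only linearly many powers fit within a given length
(`le_mul_ncard_of_fourPoint`). -/

section WordMetric

/-! ### Word metrics and distorted elements in hyperbolic groups -/

variable {G : Type*} [Group G] {S : Set G}

theorem mulCayley_connected (hS : Subgroup.closure S = ⊤) :
    (SimpleGraph.mulCayley S).Connected := by
  have key : ∀ g : G, (SimpleGraph.mulCayley S).Reachable 1 g := by
    intro g
    have hg : g ∈ Subgroup.closure S := hS ▸ Subgroup.mem_top g
    have step : ∀ x s : G, (s ∈ S ∨ s⁻¹ ∈ S) → (SimpleGraph.mulCayley S).Reachable x (x * s) := by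
      intro x s hs
      by_cases h : x = x * s
      · rw [← h]
      · refine SimpleGraph.Adj.reachable ((SimpleGraph.mulCayley_adj S _ _).mpr ⟨h, ?_⟩)
        simpa using hs
    induction hg using Subgroup.closure_induction_right with
    | one => exact SimpleGraph.Reachable.refl _
    | mul_right x _ s hs ih => exact ih.trans (step _ _ (Or.inl hs))
    | mul_inv_cancel x _ s hs ih => exact ih.trans (step _ _ (Or.inr (by simpa using hs)))
  have : Nonempty G := ⟨1⟩
  exact ⟨fun x y => (key x).symm.trans (key y)⟩

theorem mulCayley_dist_mul_left (hS : Subgroup.closure S = ⊤) (g x y : G) :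
    (SimpleGraph.mulCayley S).dist (g * x) (g * y) = (SimpleGraph.mulCayley S).dist x y := by
  have key : ∀ g x y : G,
      (SimpleGraph.mulCayley S).dist (g * x) (g * y) ≤ (SimpleGraph.mulCayley S).dist x y := by
    intro g x y
    obtain ⟨p, hp⟩ := (mulCayley_connected hS).exists_walk_length_eq_dist x y
    let f : SimpleGraph.mulCayley S →g SimpleGraph.mulCayley S :=
      ⟨fun x => g * x, fun h => SimpleGraph.mulCayley_adj_mul_iff_right.mpr h⟩
    calc _ ≤ (p.map f).length := SimpleGraph.dist_le (p.map f)
      _ = _ := by rw [SimpleGraph.Walk.length_map, hp]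
  refine le_antisymm (key g x y) ?_
  simpa using key g⁻¹ (g * x) (g * y)

theorem SimpleGraph.Connected.exists_dist_eq_add {V : Type*} {Γ : SimpleGraph V}
    (hΓ : Γ.Connected) {x y : V} {t : ℕ} (ht : t ≤ Γ.dist x y) :
    ∃ u, Γ.dist x u = t ∧ t + Γ.dist u y = Γ.dist x y := by
  obtain ⟨p, hp⟩ := hΓ.exists_walk_length_eq_dist x y
  have h1 := Γ.dist_le (p.take t)
  have h2 := Γ.dist_le (p.drop t)
  have h3 := hΓ.dist_triangle (u := x) (v := p.getVert t) (w := y)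
  rw [SimpleGraph.Walk.take_length] at h1
  rw [SimpleGraph.Walk.drop_length] at h2
  exact ⟨p.getVert t, by omega, by omega⟩

theorem mulCayley_finite_dist_le (hfin : S.Finite) (hS : Subgroup.closure S = ⊤) (r : ℕ) :
    {g : G | (SimpleGraph.mulCayley S).dist 1 g ≤ r}.Finite := by
  have hconn := mulCayley_connected hS
  induction r with
  | zero =>
    refine (Set.finite_singleton (1 : G)).subset fun g hg => ?_
    have hg' : (SimpleGraph.mulCayley S).dist 1 g = 0 := Nat.le_zero.mp hg
    exact (hconn.dist_eq_zero_iff.mp hg').symm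
  | succ r ih =>
    refine (ih.union (Set.Finite.image2 (· * ·) ih (hfin.union hfin.inv))).subset fun g hg => ?_
    rcases Nat.lt_or_ge r ((SimpleGraph.mulCayley S).dist 1 g) with h | h
    · right
      obtain ⟨u, hu, hu'⟩ := hconn.exists_dist_eq_add h.le
      have hg' : (SimpleGraph.mulCayley S).dist 1 g ≤ r + 1 := hg
      have hadj : (SimpleGraph.mulCayley S).Adj u g :=
        SimpleGraph.dist_eq_one_iff_adj.mp (by omega)
      refine ⟨u, hu.le, u⁻¹ * g, ?_, by simp⟩
      rcases ((SimpleGraph.mulCayley_adj S _ _).mp hadj).2 with h' | h'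
      · exact Or.inl h'
      · exact Or.inr (by simpa using h')
    · exact Or.inl h

theorem mulCayley_dist_one_mul_le (hS : Subgroup.closure S = ⊤) (x y : G) :
    (SimpleGraph.mulCayley S).dist 1 (x * y) ≤
      (SimpleGraph.mulCayley S).dist 1 x + (SimpleGraph.mulCayley S).dist 1 y := by
  have h := (mulCayley_connected hS).dist_triangle (u := 1) (v := x) (w := x * y)
  have h' := mulCayley_dist_mul_left hS x 1 y
  rw [mul_one] at h'
  omega

theorem mulCayley_dist_one_inv (hS : Subgroup.closure S = ⊤) (x : G) :
    (SimpleGraph.mulCayley S).dist 1 x⁻¹ = (SimpleGraph.mulCayley S).dist 1 x := by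
  have h := mulCayley_dist_mul_left hS x 1 x⁻¹
  rw [mul_one, mul_inv_cancel, SimpleGraph.dist_comm] at h
  exact h.symm

theorem mulCayley_dist_one_pow_le (hS : Subgroup.closure S = ⊤) (x : G) (n : ℕ) :
    (SimpleGraph.mulCayley S).dist 1 (x ^ n) ≤ n * (SimpleGraph.mulCayley S).dist 1 x := by
  induction n with
  | zero => simp
  | succ n ih =>
    have h := mulCayley_dist_one_mul_le hS (x ^ n) x
    rw [pow_succ, Nat.succ_mul]
    omega

/-- The powers of an element conjugate to its `Q`-th power have logarithmic length. -/
theorem mulCayley_dist_one_pow_le_of_conj_eq_pow (hS : Subgroup.closure S = ⊤) {a b : G} {Q : ℕ}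
    (hQ : 2 ≤ Q) (hab : b * a * b⁻¹ = a ^ Q) :
    ∃ C : ℕ, ∀ k n : ℕ, n < Q ^ k → (SimpleGraph.mulCayley S).dist 1 (a ^ n) ≤ C * k := by
  -- Each base-Q digit of n costs one conjugation by b and at most Q further letters a, as in
  -- Horner's scheme.
  refine ⟨2 * (SimpleGraph.mulCayley S).dist 1 b + Q * (SimpleGraph.mulCayley S).dist 1 a,
    fun k => ?_⟩
  induction k with
  | zero =>
    intro n hn
    obtain rfl : n = 0 := by simpa using hn
    simp
  | succ k ih =>
    intro n hn
    have hdiv : n / Q < Q ^ k := Nat.div_lt_of_lt_mul (by rwa [pow_succ'] at hn)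
    have hmod : n % Q ≤ Q := (Nat.mod_lt _ (by omega)).le
    have hdec : a ^ n = b * a ^ (n / Q) * b⁻¹ * a ^ (n % Q) := by
      rw [← conj_pow, hab, ← pow_mul, ← pow_add, Nat.div_add_mod]
    have h1 := mulCayley_dist_one_mul_le hS (b * a ^ (n / Q) * b⁻¹) (a ^ (n % Q))
    have h2 := mulCayley_dist_one_mul_le hS (b * a ^ (n / Q)) b⁻¹
    have h3 := mulCayley_dist_one_mul_le hS b (a ^ (n / Q))
    have h4 := mulCayley_dist_one_pow_le hS a (n % Q)
    have h5 := Nat.mul_le_mul_right ((SimpleGraph.mulCayley S).dist 1 a) hmod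
    have h6 := ih _ hdiv
    rw [mulCayley_dist_one_inv hS] at h2
    rw [hdec, Nat.mul_succ]
    omega

theorem exists_mul_lt_two_pow (C V : ℕ) : ∃ k : ℕ, (2 * (C * k) + 1) * V < 2 ^ k := by
  -- With k = 2j, one factor 2^j absorbs j + 1 and the other absorbs the constant j.
  set j := (4 * C + 1) * V with hj
  refine ⟨j + j, ?_⟩
  have h : j + 1 ≤ 2 ^ j := Nat.lt_two_pow_self
  calc (2 * (C * (j + j)) + 1) * V ≤ ((4 * C + 1) * (j + 1)) * V := by
        gcongr
        nlinarith
    _ = j * (j + 1) := by rw [hj]; ring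
    _ < 2 ^ j * 2 ^ j := by nlinarith
    _ = 2 ^ (j + j) := (pow_add 2 j j).symm

/-- In a hyperbolic group, an element whose first `N` powers have length at most `R` and which
has a power of length at least `2 * R` satisfies `N ≤ (2 * R + 1) * V`, for a constant `V`. -/
theorem le_mul_ncard_of_fourPoint (hfin : S.Finite) (hS : Subgroup.closure S = ⊤) {δ : ℕ}
    (hδ : ∀ x y z w : G,
      (SimpleGraph.mulCayley S).dist x y + (SimpleGraph.mulCayley S).dist z w ≤
        max ((SimpleGraph.mulCayley S).dist x z + (SimpleGraph.mulCayley S).dist y w)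
          ((SimpleGraph.mulCayley S).dist x w + (SimpleGraph.mulCayley S).dist y z) + 2 * δ)
    {a : G} (ha : Function.Injective fun n : ℕ => a ^ n) {N R M : ℕ}
    (hN : ∀ i < N, (SimpleGraph.mulCayley S).dist 1 (a ^ i) ≤ R)
    (hM : 2 * R ≤ (SimpleGraph.mulCayley S).dist 1 (a ^ M)) :
    N ≤ (2 * R + 1) * {g : G | (SimpleGraph.mulCayley S).dist 1 g ≤ 8 * δ}.ncard := by
  have hconn := mulCayley_connected hS
  have hball := mulCayley_finite_dist_le hfin hS (8 * δ)
  have hinv := mulCayley_dist_mul_left hS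
  set d := (SimpleGraph.mulCayley S).dist with hd
  have hcomm : ∀ x y, d x y = d y x := fun x y => SimpleGraph.dist_comm
  have htri : ∀ x y z, d x z ≤ d x y + d y z := fun x y z => hconn.dist_triangle
  set y := a ^ M with hy
  set L := d 1 y with hL
  have hgeo : ∀ t : ℕ, ∃ u : G, t ≤ L → d 1 u = t ∧ t + d u y = L := by
    intro t
    by_cases ht : t ≤ L
    · obtain ⟨u, hu⟩ := hconn.exists_dist_eq_add ht
      exact ⟨u, fun _ => hu⟩
    · exact ⟨1, fun h => absurd h ht⟩
  choose u hu using hgeo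
  obtain ⟨hp1, hp2⟩ := hu R (by omega)
  set p := u R with hp
  -- Since a^i commutes with y, translation by a^i moves both 1 and y by at most R. The translated
  -- geodesic thus stays close to the original around its point a^i * p.
  have near : ∀ i < N, d 1 (a ^ i * p) ≤ 2 * R ∧
      d (u (min (d 1 (a ^ i * p)) L)) (a ^ i * p) ≤ 8 * δ := by
    intro i hi
    have hxx := hN i hi
    have hxz : d (a ^ i) (a ^ i * p) = R := by
      have := hinv (a ^ i) 1 p
      rw [mul_one] at this
      rw [this, hp1]
    have hzy : d (a ^ i * p) (a ^ i * y) = d p y := hinv _ _ _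
    have hxy : d (a ^ i) (a ^ i * y) = L := by
      have := hinv (a ^ i) 1 y
      rwa [mul_one] at this
    have hyy : d y (a ^ i * y) ≤ R := by
      have h := hinv y 1 (a ^ i)
      rw [mul_one] at h
      have hc : y * a ^ i = a ^ i * y := by rw [hy, ← pow_add, ← pow_add, add_comm]
      rw [← hc, h]
      exact hxx
    set x' := a ^ i with hx'
    set z := x' * p with hz
    set y' := x' * y with hy'
    -- Because L ≥ 2R, `e1`, `e2` and `e3` together give d(1,z) + d(z,y) ≤ L + 6δ; `e4` then puts z
    -- within 8δ of the geodesic point at its own distance from 1.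
    have e1 := hδ z 1 y' x'
    have e2 := hδ z y x' y'
    have e3 := hδ 1 y' x' y
    have t1 := htri 1 y' y
    have t2 := htri x' y y'
    have t3 := htri 1 x' z
    obtain ⟨f1, f2⟩ := hu (min (d 1 z) L) (min_le_right _ _)
    have e4 := hδ z (u (min (d 1 z) L)) 1 y
    simp only [hcomm z 1, hcomm y' x', hcomm y' y, hcomm y x', hcomm z x',
      hcomm (u (min (d 1 z) L)) 1, hcomm z (u (min (d 1 z) L))] at e1 e2 e3 e4 t1 t2 t3 ⊢
    refine ⟨by omega, ?_⟩
    omega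
  set B := {g : G | d 1 g ≤ 8 * δ} with hB
  -- The exponent i is recovered from a position on the geodesic, at most 2R, and an offset in the
  -- ball of radius 8δ.
  have hcard := Finset.card_le_card_of_injOn (s := Finset.range N)
    (t := Finset.range (2 * R + 1) ×ˢ hball.toFinset)
    (fun i => (min (d 1 (a ^ i * p)) L, (u (min (d 1 (a ^ i * p)) L))⁻¹ * (a ^ i * p)))
    (by
      intro i hi
      obtain ⟨h1, h2⟩ := near i (by simpa using hi)
      have h3 := hinv (u (min (d 1 (a ^ i * p)) L))⁻¹ (u (min (d 1 (a ^ i * p)) L)) (a ^ i * p)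
      rw [inv_mul_cancel] at h3
      simp only [Finset.coe_product, Set.mem_prod, Finset.mem_coe, Finset.mem_range,
        Set.Finite.mem_toFinset]
      exact ⟨by omega, h3.trans_le h2⟩)
    (by
      intro i _ j _ hij
      simp only [Prod.mk.injEq] at hij
      obtain ⟨h1, h2⟩ := hij
      rw [h1] at h2
      exact ha (mul_right_cancel (mul_left_cancel h2)))
  rwa [Finset.card_range, Finset.card_product, Finset.card_range,
    ← Set.ncard_eq_toFinset_card B hball] at hcard

theorem not_isHyperbolicGroup_of_conj_eq_pow {a b : G} (ha : orderOf a = 0) {Q : ℕ} (hQ : 2 ≤ Q)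
    (hab : b * a * b⁻¹ = a ^ Q) : ¬ IsHyperbolicGroup G := by
  rintro ⟨S, hfin, hS, δ, hδ⟩
  have hinj : Function.Injective fun n : ℕ => a ^ n :=
    injective_pow_iff_not_isOfFinOrder.mpr (orderOf_eq_zero_iff.mp ha)
  obtain ⟨C, hC⟩ := mulCayley_dist_one_pow_le_of_conj_eq_pow hS hQ hab
  obtain ⟨k, hk⟩ := exists_mul_lt_two_pow C
    {g : G | (SimpleGraph.mulCayley S).dist 1 g ≤ 8 * δ}.ncard
  obtain ⟨M, hM⟩ : ∃ M : ℕ, 2 * (C * k) ≤ (SimpleGraph.mulCayley S).dist 1 (a ^ M) := by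
    by_contra! h
    exact Set.infinite_of_injective_forall_mem hinj (fun M => (h M).le)
      (mulCayley_finite_dist_le hfin hS (2 * (C * k)))
  have h := le_mul_ncard_of_fourPoint hfin hS hδ hinj (fun i hi => hC k i hi) hM
  exact absurd (h.trans_lt hk) (not_lt.mpr (Nat.pow_le_pow_left hQ k))

end WordMetric

/-! ### Normal forms and embeddings of BS(1,q) -/

section BaumslagSolitar

theorem conj_pow_eq_pow_pow {G : Type*} [Group G] {a b : G} {q : ℤ} (hab : b * a * b⁻¹ = a ^ q)
    (i : ℕ) : b ^ i * a * (b ^ i)⁻¹ = a ^ q ^ i := by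
  induction i with
  | zero => simp
  | succ i ih =>
    calc b ^ (i + 1) * a * (b ^ (i + 1))⁻¹ = b * (b ^ i * a * (b ^ i)⁻¹) * b⁻¹ := by
          rw [pow_succ']; group
      _ = a ^ q ^ (i + 1) := by rw [ih, ← conj_zpow, hab, ← zpow_mul, ← pow_succ']

namespace BaumslagSolitarGroup

variable {q : ℤ}

theorem conj_of_zero :
    (PresentedGroup.of 1 : BaumslagSolitarGroup 1 q) * PresentedGroup.of 0 * (PresentedGroup.of 1)⁻¹
      = PresentedGroup.of 0 ^ q := by
  have h := PresentedGroup.one_of_mem (Set.mem_singleton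
    (FreeGroup.of 1 * FreeGroup.of 0 ^ (1 : ℤ) * (FreeGroup.of 1)⁻¹ * (FreeGroup.of 0 ^ q)⁻¹ :
      FreeGroup (Fin 2)))
  simp only [map_mul, map_inv, map_zpow, zpow_one] at h
  exact mul_inv_eq_one.mp h

/-- The set of such products contains 1 and is stable under left multiplication by the generators
and their inverses: powers of a move right past b⁻ⁱ by raising the exponent to its qⁱ-fold. -/
theorem exists_eq_mul (g : BaumslagSolitarGroup 1 q) : ∃ (i j : ℕ) (n : ℤ),
    g = (PresentedGroup.of 1 ^ i)⁻¹ * PresentedGroup.of 0 ^ n * PresentedGroup.of 1 ^ j := by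
  have hg : g ∈ Subgroup.closure (Set.range PresentedGroup.of) := by
    rw [PresentedGroup.closure_range_of]; trivial
  set a : BaumslagSolitarGroup 1 q := PresentedGroup.of 0
  set b : BaumslagSolitarGroup 1 q := PresentedGroup.of 1
  have hab : b * a * b⁻¹ = a ^ q := conj_of_zero
  have move : ∀ (i : ℕ) (m : ℤ), a ^ m * (b ^ i)⁻¹ = (b ^ i)⁻¹ * a ^ (q ^ i * m) := by
    intro i m
    rw [zpow_mul, ← conj_pow_eq_pow_pow hab, conj_zpow]
    group
  have mul_a : ∀ (m : ℤ) (y : BaumslagSolitarGroup 1 q),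
      (∃ (i j : ℕ) (n : ℤ), y = (b ^ i)⁻¹ * a ^ n * b ^ j) →
        ∃ (i j : ℕ) (n : ℤ), a ^ m * y = (b ^ i)⁻¹ * a ^ n * b ^ j := by
    rintro m _ ⟨i, j, n, rfl⟩
    refine ⟨i, j, q ^ i * m + n, ?_⟩
    rw [← mul_assoc, ← mul_assoc, move, zpow_add]
    simp only [mul_assoc]
  induction hg using Subgroup.closure_induction_left with
  | one => exact ⟨0, 0, 0, by simp⟩
  | mul_left x hx y _ ih =>
    obtain ⟨k, rfl⟩ := hx
    fin_cases k
    · simpa using mul_a 1 y ih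
    · obtain ⟨i, j, n, rfl⟩ := ih
      change ∃ (i' j' : ℕ) (n' : ℤ), b * _ = _
      cases i with
      | zero =>
        refine ⟨0, j + 1, q * n, ?_⟩
        rw [zpow_mul, ← hab, conj_zpow, pow_succ']
        group
      | succ i =>
        refine ⟨i, j, n, ?_⟩
        rw [pow_succ]
        group
  | inv_mul_cancel x hx y _ ih =>
    obtain ⟨k, rfl⟩ := hx
    fin_cases k
    · simpa using mul_a (-1) y ih
    · obtain ⟨i, j, n, rfl⟩ := ih
      change ∃ (i' j' : ℕ) (n' : ℤ), b⁻¹ * _ = _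
      refine ⟨i + 1, j, n, ?_⟩
      rw [pow_succ]
      group

end BaumslagSolitarGroup

/-- The equation makes bⁱ b⁻ʲ a power of a, so it commutes with a. Then bⁱ and bʲ conjugate a to the
same element, whence qⁱ = qʲ and i = j, leaving aⁿ = 1. -/
theorem eq_of_pow_mul_zpow_eq_pow {G : Type*} [Group G] {a b : G} {q : ℤ} (ha : orderOf a = 0)
    (hq : 2 ≤ q.natAbs) (hab : b * a * b⁻¹ = a ^ q) {i j : ℕ} {n : ℤ}
    (h : (b ^ i)⁻¹ * a ^ n * b ^ j = 1) : i = j ∧ n = 0 := by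
  have hinj : Function.Injective fun n : ℤ => a ^ n :=
    injective_zpow_iff_not_isOfFinOrder.mpr (orderOf_eq_zero_iff.mp ha)
  have h1 : a ^ n = b ^ i * (b ^ j)⁻¹ := by
    calc a ^ n = b ^ i * ((b ^ i)⁻¹ * a ^ n * b ^ j) * (b ^ j)⁻¹ := by simp [mul_assoc]
      _ = _ := by rw [h, mul_one]
  have h2 : a ^ q ^ i = a ^ q ^ j := by
    have hcomm : b ^ i * (b ^ j)⁻¹ = (b ^ j)⁻¹ * b ^ i :=
      ((Commute.refl b).pow_pow i j).inv_right
    have hfix : a ^ n * a * (a ^ n)⁻¹ = a := by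
      rw [((Commute.refl a).zpow_left n).eq, mul_inv_cancel_right]
    rw [h1, hcomm] at hfix
    rw [← conj_pow_eq_pow_pow hab, ← conj_pow_eq_pow_pow hab]
    nth_rw 2 [← hfix]
    simp [mul_assoc]
  have h3 : q ^ i = q ^ j := hinj h2
  have hij : i = j := by
    have := congrArg Int.natAbs h3
    rw [Int.natAbs_pow, Int.natAbs_pow] at this
    exact Nat.pow_right_injective hq this
  subst hij
  refine ⟨rfl, hinj ?_⟩
  simpa using h1

theorem containsGroup_baumslagSolitarGroup {G : Type*} [Group G] {a b : G} {q : ℤ}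
    (ha : orderOf a = 0) (hq : 2 ≤ q.natAbs) (hab : b * a * b⁻¹ = a ^ q) :
    ContainsGroup G (BaumslagSolitarGroup 1 q) := by
  refine ⟨PresentedGroup.toGroup (f := ![a, b]) ?_, ?_⟩
  · rintro _ rfl
    simp [hab]
  · rw [injective_iff_map_eq_one]
    intro g hg
    obtain ⟨i, j, n, rfl⟩ := BaumslagSolitarGroup.exists_eq_mul g
    simp only [map_mul, map_inv, map_pow, map_zpow, PresentedGroup.toGroup.of] at hg
    obtain ⟨rfl, rfl⟩ := eq_of_pow_mul_zpow_eq_pow ha hq hab (by simpa using hg)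
    simp

end BaumslagSolitar

/-! ### The group H(9,4) and its shift extension -/

namespace GilbertHowieGroup

open PresentedGroup in
theorem relation_nine_four :
    (of 1 * of 8 * of 0 ^ 2 * (of 8)⁻¹ : GilbertHowieGroup 9 4) = 1 := by
  have h : ∀ i j k : ZMod 9, i + 4 = j → i + 1 = k →
      (of i * of j : GilbertHowieGroup 9 4) = of k := by
    rintro i _ _ rfl rfl
    exact FibonacciTypeGroup.of_mul_of i
  have h04 := h 0 4 1 (by decide) (by decide)
  have h48 := h 4 8 5 (by decide) (by decide)
  have h50 := h 5 0 6 (by decide) (by decide)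
  have h61 := h 6 1 7 (by decide) (by decide)
  have h37 := h 3 7 4 (by decide) (by decide)
  have h83 := h 8 3 0 (by decide) (by decide)
  -- Indeed x_6 x_0 x_3 x_7 = x_6 x_0 x_4 = x_6 x_1 = x_7.
  have h60 : (of 6 * of 0 : GilbertHowieGroup 9 4) = (of 3)⁻¹ := by
    rw [eq_inv_iff_mul_eq_one, ← mul_left_inj (of 7), mul_assoc, h37, mul_assoc, h04, h61, one_mul]
  calc (of 1 * of 8 * of 0 ^ 2 * (of 8)⁻¹ : GilbertHowieGroup 9 4)
      = of 0 * (of 4 * of 8) * of 0 ^ 2 * (of 8)⁻¹ := by rw [← h04]; simp only [mul_assoc]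
    _ = of 0 * (of 5 * of 0 * of 0) * (of 8)⁻¹ := by rw [h48, pow_two]; simp only [mul_assoc]
    _ = of 0 * (of 8 * of 3)⁻¹ := by rw [h50, h60, mul_inv_rev]; simp only [mul_assoc]
    _ = 1 := by rw [h83, mul_inv_cancel]

/-- The homomorphism `x_i ↦ (-2)^i` from `H(9,4)` to the cyclic group of order `19`. -/
def toZModNineteen : GilbertHowieGroup 9 4 →* Multiplicative (ZMod 19) :=
  PresentedGroup.toGroup (f := fun i => Multiplicative.ofAdd ((-2) ^ i.val)) (by
    rintro _ ⟨i, rfl⟩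
    simp only [map_mul, map_inv, FreeGroup.lift_apply_of, ← ofAdd_add, ← ofAdd_neg, ofAdd_eq_one]
    -- Modulo 19, (-2)^9 = 1, so exponents may be read mod 9, and 1 + (-2)^4 = -2 gives the
    -- relation.
    revert i
    decide)

theorem orderOf_of_zero
    (hfin : ∀ K : Subgroup (GilbertHowieGroup 9 4), Finite K → Nat.card K ≤ 2) :
    orderOf (PresentedGroup.of 0 : GilbertHowieGroup 9 4) = 0 := by
  by_contra h
  have hdvd : 19 ∣ orderOf (PresentedGroup.of 0 : GilbertHowieGroup 9 4) := by
    have h1 := orderOf_map_dvd toZModNineteen (PresentedGroup.of 0)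
    have h2 : toZModNineteen (PresentedGroup.of 0) = Multiplicative.ofAdd 1 := by
      simp [toZModNineteen]
    rwa [h2, orderOf_ofAdd_eq_addOrderOf, ZMod.addOrderOf_one] at h1
  have hle := hfin (Subgroup.zpowers (PresentedGroup.of 0))
    (Nat.finite_of_card_ne_zero (by rwa [Nat.card_zpowers]))
  rw [Nat.card_zpowers] at hle
  exact absurd (Nat.le_of_dvd (Nat.pos_of_ne_zero h) hdvd) (by omega)

/-- The element `x_8⁻¹ t` of the shift extension. -/
def stableLetter : ShiftExtension 9 4 1 :=
  ⟨(PresentedGroup.of 8)⁻¹, Multiplicative.ofAdd 1⟩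

theorem stableLetter_conj :
    stableLetter * SemidirectProduct.inl (PresentedGroup.of 0) * stableLetter⁻¹ =
      SemidirectProduct.inl (PresentedGroup.of 0) ^ (-2 : ℤ) := by
  have ht : FibonacciTypeGroup.shiftAction 9 4 1 (Multiplicative.ofAdd 1) (PresentedGroup.of 0) =
      PresentedGroup.of 1 := FibonacciTypeGroup.shift_of 0 1
  have hs : stableLetter = SemidirectProduct.inl (PresentedGroup.of 8)⁻¹ *
      SemidirectProduct.inr (Multiplicative.ofAdd 1) := (SemidirectProduct.mk_eq_inl_mul_inr _ _)
  have hr : ((PresentedGroup.of 8)⁻¹ * PresentedGroup.of 1 * PresentedGroup.of 8 :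
      GilbertHowieGroup 9 4) = PresentedGroup.of 0 ^ (-2 : ℤ) := by
    -- Conjugating `relation_nine_four` by x_8 gives x_8⁻¹ x_1 x_8 x_0² = 1.
    rw [zpow_neg, eq_inv_iff_mul_eq_one]
    have h := congrArg (fun g => (PresentedGroup.of 8)⁻¹ * g * PresentedGroup.of 8)
      relation_nine_four
    simpa [mul_assoc] using h
  rw [← map_zpow, ← hr, hs, map_mul, map_mul, ← ht, SemidirectProduct.inl_aut]
  simp [mul_assoc]

theorem exists_inl_eq_stableLetter_pow :
    ∃ h : GilbertHowieGroup 9 4, SemidirectProduct.inl h = stableLetter ^ 9 := by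
  refine ⟨(stableLetter ^ 9).left, SemidirectProduct.ext ?_ ?_⟩
  · simp
  · rw [SemidirectProduct.right_inl]
    change 1 = SemidirectProduct.rightHom (stableLetter ^ 9)
    rw [map_pow]
    decide

theorem exists_conj_of_zero : ∃ h : GilbertHowieGroup 9 4,
    h * PresentedGroup.of 0 * h⁻¹ = PresentedGroup.of 0 ^ (-512 : ℤ) := by
  obtain ⟨h, hh⟩ := exists_inl_eq_stableLetter_pow
  refine ⟨h, SemidirectProduct.inl_injective (φ := FibonacciTypeGroup.shiftAction 9 4 1) ?_⟩
  rw [map_mul, map_mul, map_inv, map_zpow, hh, conj_pow_eq_pow_pow stableLetter_conj]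
  norm_num

end GilbertHowieGroup

theorem mainTheorem5
    (hfin : ∀ K : Subgroup (GilbertHowieGroup 9 4), Finite K → Nat.card K ≤ 2) :
    ContainsGroup (ShiftExtension 9 4 1) (BaumslagSolitarGroup 1 (-8)) ∧
      ContainsGroup (GilbertHowieGroup 9 4) (BaumslagSolitarGroup 1 (-512)) ∧
      ¬ IsHyperbolicGroup (GilbertHowieGroup 9 4) := by
  have hord := GilbertHowieGroup.orderOf_of_zero hfin
  obtain ⟨h, hh⟩ := GilbertHowieGroup.exists_conj_of_zero
  refine ⟨?_, containsGroup_baumslagSolitarGroup hord (by decide) hh, ?_⟩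
  · refine containsGroup_baumslagSolitarGroup (a := SemidirectProduct.inl (PresentedGroup.of 0))
      (b := GilbertHowieGroup.stableLetter ^ 3) ?_ (by decide) ?_
    · rw [orderOf_injective _ SemidirectProduct.inl_injective, hord]
    · rw [conj_pow_eq_pow_pow GilbertHowieGroup.stableLetter_conj]
      norm_num
  -- Squaring h turns the negative exponent -512 into the positive 512².
  · refine not_isHyperbolicGroup_of_conj_eq_pow (b := h ^ 2) (Q := 512 ^ 2) hord (by norm_num) ?_
    rw [conj_pow_eq_pow_pow hh, ← zpow_natCast]
    norm_num
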